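/- Let $dA(z)=\frac{dx\,dy}{\pi}$ be the normalized area measure on $\mathbb C$, let $\mathbb D(0,R)$ be the open disk of radius $R$ centred at $0$, and for an entire function $f$ and $R>0$ put $$\Psi_f(z,R)=\bigl(|f(z)|e^{-|z|^2}-1_{\mathbb D(0,R)}(z)\bigr)^2 ,\qquad z\in\mathbb C.$$ Define the planar discrepancy densities $$\rho_{\mathbb C}=\liminf_{R\to\infty}\ \inf_{f\in\operatorname{Pol}(\mathbb C)}\frac{\int_{\mathbb D(0,R)}\Psi_f(z,R)\,dA(z)}{\int_{\mathbb D(0,R)}dA(z)},\qquad \rho_{\mathbb C}^*=\liminf_{R\to\infty}\ \inf_{f\in\operatorname{Pol}(\mathbb C)}\frac{\int_{\mathbb C}\Psi_f(z,R)\,dA(z)}{\int_{\mathbb D(0,R)}dA(z)},$$ where $\operatorname{Pol}(\mathbb C)$ is the set of all complex polynomials. Let $\operatorname{Pol}_n(\mathbb C)$ be the set of complex polynomials of degree at most $n-1$ (including the zero polynomial), and let $n(R)=\lceil 2R^2\rceil$. Then $$\rho_{\mathbb C}=\liminf_{R\to\infty}\ \inf_{f\in\operatorname{Pol}_{n(R)}(\mathbb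 C)}\frac{\int_{\mathbb D(0,R)}\Psi_f(z,R)\,dA(z)}{\int_{\mathbb D(0,R)}dA(z)}\qquad\text{and}\qquad \rho_{\mathbb C}^*=\liminf_{R\to\infty}\ \inf_{f\in\operatorname{Pol}_{n(R)}(\mathbb C)}\frac{\int_{\mathbb C}\Psi_f(z,R)\,dA(z)}{\int_{\mathbb D(0,R)}dA(z)}.$$ -/

import Mathlib

open Filter MeasureTheory
open scoped ENNReal Polynomial

noncomputable section

namespace PlanarDiscrepancy

/-- The normalized area measure `dA = dx dy / π` on the complex plane. -/
def areaMeasure : Measure ℂ := ENNReal.ofReal (Real.pi⁻¹) • (volume : Measure ℂ)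

/-- The planar discrepancy function
`Ψ_f(z, R) = (|f(z)| e^{-|z|²} - 1_{D(0,R)}(z))²`, with `D(0,R)` the open disk. -/
def discrepancy (f : ℂ → ℂ) (R : ℝ) (z : ℂ) : ℝ :=
  (‖f z‖ * Real.exp (-‖z‖ ^ 2) - (Metric.ball (0 : ℂ) R).indicator (fun _ => (1 : ℝ)) z) ^ 2

/-- `(∫_{D(0,R)} Ψ_f(z, R) dA(z)) / (∫_{D(0,R)} dA(z))`. The integrand is nonnegative, so the
integral is taken with values in `[0, ∞]`. -/
def meanDiscrepancy (f : ℂ → ℂ) (R : ℝ) : ℝ≥0∞ :=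
  (∫⁻ z in Metric.ball (0 : ℂ) R, ENNReal.ofReal (discrepancy f R z) ∂areaMeasure) /
    ∫⁻ _z in Metric.ball (0 : ℂ) R, 1 ∂areaMeasure

/-- `(∫_ℂ Ψ_f(z, R) dA(z)) / (∫_{D(0,R)} dA(z))`. -/
def tightMeanDiscrepancy (f : ℂ → ℂ) (R : ℝ) : ℝ≥0∞ :=
  (∫⁻ z, ENNReal.ofReal (discrepancy f R z) ∂areaMeasure) /
    ∫⁻ _z in Metric.ball (0 : ℂ) R, 1 ∂areaMeasure

/-- The planar discrepancy density `ρ_ℂ`: the infimum is over all complex polynomials. -/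
def planarDensity : ℝ≥0∞ :=
  liminf (fun R : ℝ => ⨅ p : ℂ[X], meanDiscrepancy (fun z => p.eval z) R) atTop

/-- The tight planar discrepancy density `ρ_ℂ^*`. -/
def tightPlanarDensity : ℝ≥0∞ :=
  liminf (fun R : ℝ => ⨅ p : ℂ[X], tightMeanDiscrepancy (fun z => p.eval z) R) atTop

/-- `Pol_n(ℂ)`: the complex polynomials of degree at most `n - 1`, that is, of degree `< n`
(the zero polynomial included). -/
def polLT (n : ℕ) : Set ℂ[X] := {p | p.degree < n}

/-- `n(R) = ⌈2R²⌉`. -/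
def degreeBound (R : ℝ) : ℕ := ⌈2 * R ^ 2⌉₊

end PlanarDiscrepancy

end

/-!
Truncating a polynomial `p` below degree `n ≥ 2R²` costs little in the normalized `L²` norm of
`|p| e^{-|z|²} - 1_{D(0,R)}`. Fix `0 < c < 1`. Monomials are orthogonal on circles, so the discarded
part has quadratic mean `(∑_{k ≥ n} |p_k|² r^{2k})^{1/2}` on `|z| = r`. As `r ^ n e^{-r²}` increases
on `[0, R]`, its weighted norm on `D(0,cR)` is at most `(c e^{(1 - c²)/2})^n` times the one on
`D(0,R)`, and this factor tends to `0`. Outside `D(0,cR)` the same orthogonality shows that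
truncation decreases the weighted norm, while the indicator is supported on an annulus of
normalized area `1 - c²`. Let first `R → ∞` and then `c → 1`.
-/

namespace PlanarDiscrepancy

section Measure

lemma smulInvariantMeasure_restrict {G X : Type*} [Group G] [MulAction G X] [MeasurableSpace X]
    [MeasurableConstSMul G X] (μ : Measure X) [SMulInvariantMeasure G X μ] {S : Set X}
    (hS : ∀ g : G, (g • ·) ⁻¹' S = S) : SMulInvariantMeasure G X (μ.restrict S) where
  measure_preimage_smul g s hs := by
    rw [Measure.restrict_apply (measurable_const_smul g hs), Measure.restrict_apply hs]
    nth_rw 1 [← hS g]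
    rw [← Set.preimage_inter, measure_preimage_smul]

lemma measure_le_map_smul {E : Type*} [NormedAddCommGroup E] [NormedSpace ℝ E]
    [MeasurableSpace E] [BorelSpace E] [FiniteDimensional ℝ E] (μ : Measure E)
    [μ.IsAddHaarMeasure] {c : ℝ} (hc : 0 < c) (hc1 : c ≤ 1) : μ ≤ μ.map (c • ·) := by
  rw [Measure.map_addHaar_smul μ hc.ne', abs_of_pos (by positivity)]
  intro s
  exact le_mul_of_one_le_left' <| ENNReal.one_le_ofReal.2 <|
    (one_le_inv₀ (by positivity)).2 (pow_le_one₀ hc.le hc1)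

lemma eLpNorm_restrict_ball_mul_le {E F : Type*} [NormedAddCommGroup E] [NormedSpace ℝ E]
    [MeasurableSpace E] [BorelSpace E] [FiniteDimensional ℝ E] [NormedAddCommGroup F]
    (μ : Measure E) [μ.IsAddHaarMeasure] (q : ℝ≥0∞) {f : E → F} (hf : StronglyMeasurable f)
    {c : ℝ} (hc : 0 < c) (hc1 : c ≤ 1) (R : ℝ) :
    eLpNorm f q (μ.restrict (Metric.ball 0 (c * R))) ≤
      eLpNorm (fun z => f (c • z)) q (μ.restrict (Metric.ball 0 R)) := by
  have hball : (fun z : E => c • z) ⁻¹' Metric.ball 0 (c * R) = Metric.ball 0 R := by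
    ext z
    simp [norm_smul, abs_of_pos hc, hc]
  have hmap := Measure.restrict_mono (subset_refl (Metric.ball (0 : E) (c * R)))
    (measure_le_map_smul μ hc hc1)
  rw [Measure.restrict_map (measurable_const_smul c) measurableSet_ball, hball] at hmap
  calc eLpNorm f q (μ.restrict (Metric.ball 0 (c * R)))
      ≤ eLpNorm f q ((μ.restrict (Metric.ball 0 R)).map (c • ·)) := eLpNorm_mono_measure f hmap
    _ = eLpNorm (fun z => f (c • z)) q (μ.restrict (Metric.ball 0 R)) :=
      eLpNorm_map_measure hf.aestronglyMeasurable (measurable_const_smul c).aemeasurable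

lemma eLpNorm_two_sq {X : Type*} [MeasurableSpace X] (f : X → ℝ) (μ : Measure X) :
    eLpNorm f 2 μ ^ 2 = ∫⁻ x, ENNReal.ofReal (f x ^ 2) ∂μ := by
  have h := eLpNorm_nnreal_pow_eq_lintegral (f := f) (μ := μ) two_ne_zero
  simp only [NNReal.coe_ofNat, ENNReal.coe_ofNat, ENNReal.rpow_two] at h
  rw [h]
  refine lintegral_congr fun x => ?_
  rw [Real.enorm_eq_ofReal_abs, ← ENNReal.ofReal_pow (abs_nonneg _), sq_abs]

lemma eLpNorm_two_le_add_of_restrict_le {X : Type*} [MeasurableSpace X] {f g : X → ℝ}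
    {μ : Measure X} {S : Set X} (hS : MeasurableSet S) {a b : ℝ≥0∞}
    (ha : eLpNorm g 2 (μ.restrict S) ≤ eLpNorm f 2 (μ.restrict S) + a)
    (hb : eLpNorm g 2 (μ.restrict Sᶜ) ≤ eLpNorm f 2 (μ.restrict Sᶜ) + b) :
    eLpNorm g 2 μ ≤ eLpNorm f 2 μ + (a + b) := by
  have hsplit (h : X → ℝ) : eLpNorm h 2 μ ^ 2 =
      eLpNorm h 2 (μ.restrict S) ^ 2 + eLpNorm h 2 (μ.restrict Sᶜ) ^ 2 := by
    simp_rw [eLpNorm_two_sq, lintegral_add_compl _ hS]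
  refine (ENNReal.pow_le_pow_left_iff two_ne_zero).1 ?_
  set x := eLpNorm f 2 μ
  set x₁ := eLpNorm f 2 (μ.restrict S)
  set x₂ := eLpNorm f 2 (μ.restrict Sᶜ)
  have hx₁ : x₁ ≤ x := eLpNorm_mono_measure f Measure.restrict_le_self
  have hx₂ : x₂ ≤ x := eLpNorm_mono_measure f Measure.restrict_le_self
  calc eLpNorm g 2 μ ^ 2 ≤ (x₁ + a) ^ 2 + (x₂ + b) ^ 2 := by
        rw [hsplit g]
        gcongr
    _ = x₁ ^ 2 + x₂ ^ 2 + (2 * x₁ * a + 2 * x₂ * b + (a ^ 2 + b ^ 2)) := by ring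
    _ ≤ x ^ 2 + (2 * x * a + 2 * x * b + (a + b) ^ 2) := by
        rw [← hsplit f]
        gcongr
        rw [add_sq, add_right_comm]
        exact le_self_add
    _ = (x + (a + b)) ^ 2 := by ring

end Measure

section Truncation

variable {A : Type*} [NormedCommRing A] (p : A[X])

lemma norm_coeff_trunc_le (n k : ℕ) :
    ‖(PowerSeries.trunc n (p : PowerSeries A)).coeff k‖ ≤ ‖p.coeff k‖ := by
  rw [PowerSeries.coeff_trunc, Polynomial.coeff_coe]
  split_ifs <;> simp

lemma norm_coeff_sub_trunc_le (n k : ℕ) :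
    ‖(p - PowerSeries.trunc n (p : PowerSeries A)).coeff k‖ ≤ ‖p.coeff k‖ := by
  rw [Polynomial.coeff_sub, PowerSeries.coeff_trunc, Polynomial.coeff_coe]
  split_ifs <;> simp

lemma coeff_sub_trunc_of_lt {n k : ℕ} (hk : k < n) :
    (p - PowerSeries.trunc n (p : PowerSeries A)).coeff k = 0 := by
  rw [Polynomial.coeff_sub, PowerSeries.coeff_trunc, Polynomial.coeff_coe, if_pos hk, sub_self]

end Truncation

section CircleRMS

/-- The quadratic mean of `|p|` over the circle `|z| = r`, written in terms of the coefficients of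
`p` as in Parseval's identity. -/
noncomputable def circleRMS (p : ℂ[X]) (r : ℝ) : ℝ :=
  √(∑ k ∈ p.support, (‖p.coeff k‖ * r ^ k) ^ 2)

lemma circleRMS_nonneg (p : ℂ[X]) (r : ℝ) : 0 ≤ circleRMS p r :=
  Real.sqrt_nonneg _

@[fun_prop]
lemma continuous_circleRMS (p : ℂ[X]) : Continuous (circleRMS p) := by
  unfold circleRMS
  fun_prop

lemma circleAverage_norm_sq_eval_mul (p : ℂ[X]) (z : ℂ) :
    Real.circleAverage (fun u => ‖p.eval (z * u)‖ ^ 2) 0 1 = circleRMS p ‖z‖ ^ 2 := by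
  have h := (p.comp (.C z * .X)).sum_sq_norm_coeff_eq_circleAverage
  simp only [Polynomial.eval_comp, Polynomial.eval_mul, Polynomial.eval_C, Polynomial.eval_X,
    Polynomial.comp_C_mul_X_coeff] at h
  rw [← h, circleRMS, Real.sq_sqrt (by positivity)]
  simp only [norm_mul, norm_pow]
  refine Finset.sum_subset (fun k => ?_) fun k _ => ?_ <;>
    simp_all [Polynomial.comp_C_mul_X_coeff]

lemma circleRMS_le_of_coeff_le {p g : ℂ[X]} (h : ∀ k, ‖g.coeff k‖ ≤ ‖p.coeff k‖) {r : ℝ}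
    (hr : 0 ≤ r) : circleRMS g r ≤ circleRMS p r := by
  have hsupp : g.support ⊆ p.support := fun k hk => by
    rw [Polynomial.mem_support_iff, ← norm_pos_iff] at hk ⊢
    exact hk.trans_le (h k)
  refine Real.sqrt_le_sqrt ?_
  calc ∑ k ∈ g.support, (‖g.coeff k‖ * r ^ k) ^ 2
      ≤ ∑ k ∈ g.support, (‖p.coeff k‖ * r ^ k) ^ 2 := by
        gcongr with k
        exact h k
    _ ≤ ∑ k ∈ p.support, (‖p.coeff k‖ * r ^ k) ^ 2 :=
        Finset.sum_le_sum_of_subset_of_nonneg hsupp fun _ _ _ => sq_nonneg _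

lemma circleRMS_mul_le {p : ℂ[X]} {n : ℕ} (hp : ∀ k < n, p.coeff k = 0) {c r : ℝ} (hc : 0 ≤ c)
    (hc1 : c ≤ 1) (hr : 0 ≤ r) : circleRMS p (c * r) ≤ c ^ n * circleRMS p r := by
  rw [circleRMS, circleRMS, ← Real.sqrt_sq (pow_nonneg hc n), ← Real.sqrt_mul (sq_nonneg _),
    Finset.mul_sum]
  refine Real.sqrt_le_sqrt (Finset.sum_le_sum fun k hk => ?_)
  have hnk : n ≤ k := not_lt.1 fun hkn => Polynomial.mem_support_iff.1 hk (hp k hkn)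
  calc (‖p.coeff k‖ * (c * r) ^ k) ^ 2 = (c ^ k * (‖p.coeff k‖ * r ^ k)) ^ 2 := by ring
    _ ≤ (c ^ n * (‖p.coeff k‖ * r ^ k)) ^ 2 := by
      gcongr ?_ ^ 2
      gcongr ?_ * _
      exact pow_le_pow_of_le_one hc hc1 hnk
    _ = (c ^ n) ^ 2 * (‖p.coeff k‖ * r ^ k) ^ 2 := mul_pow _ _ _

lemma ofReal_circleRMS_sq (p : ℂ[X]) (z : ℂ) :
    ENNReal.ofReal (circleRMS p ‖z‖ ^ 2) = ENNReal.ofReal (2 * Real.pi)⁻¹ *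
      ∫⁻ θ in Set.Ioc 0 (2 * Real.pi), ENNReal.ofReal (‖p.eval (Circle.exp θ • z)‖ ^ 2) := by
  rw [← circleAverage_norm_sq_eval_mul, Real.circleAverage_def, smul_eq_mul,
    ENNReal.ofReal_mul (by positivity), intervalIntegral.integral_of_le Real.two_pi_pos.le,
    ofReal_integral_eq_lintegral_ofReal _ (.of_forall fun _ => sq_nonneg _)]
  · simp [circleMap, Circle.smul_def, mul_comm]
  · exact Continuous.integrableOn_Ioc (by fun_prop)

variable {μ : Measure ℂ} [SFinite μ] [SMulInvariantMeasure Circle ℂ μ] {w : ℝ → ℝ}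

lemma eLpNorm_two_eval_mul_radial (p : ℂ[X]) (hw : Measurable w) :
    eLpNorm (fun z => ‖p.eval z‖ * w ‖z‖) 2 μ = eLpNorm (fun z => circleRMS p ‖z‖ * w ‖z‖) 2 μ := by
  set F : ℂ → ℝ≥0∞ := fun z => ENNReal.ofReal ((‖p.eval z‖ * w ‖z‖) ^ 2) with hF
  have hmeas : Measurable F := by fun_prop
  have hrot (θ : ℝ) : ∫⁻ z, F (Circle.exp θ • z) ∂μ = ∫⁻ z, F z ∂μ :=
    (measurePreserving_smul (Circle.exp θ) μ).lintegral_comp hmeas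
  have hmean (z : ℂ) : ENNReal.ofReal ((circleRMS p ‖z‖ * w ‖z‖) ^ 2) =
      ENNReal.ofReal (2 * Real.pi)⁻¹ *
        ∫⁻ θ in Set.Ioc 0 (2 * Real.pi), F (Circle.exp θ • z) := by
    simp only [hF, mul_pow, Circle.norm_smul, ENNReal.ofReal_mul (sq_nonneg _)]
    rw [lintegral_mul_const' _ _ ENNReal.ofReal_ne_top, ← mul_assoc, ofReal_circleRMS_sq]
  refine (ENNReal.pow_right_strictMono two_ne_zero).injective ?_
  simp only [eLpNorm_two_sq, hmean]
  rw [lintegral_const_mul' _ _ ENNReal.ofReal_ne_top, lintegral_lintegral_swap]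
  · simp only [hrot, lintegral_const, Measure.restrict_apply_univ, Real.volume_Ioc, sub_zero]
    rw [mul_left_comm, ← ENNReal.ofReal_mul (by positivity),
      inv_mul_cancel₀ Real.two_pi_pos.ne', ENNReal.ofReal_one, mul_one]
  · exact (hmeas.comp (g := F) (f := fun q : ℂ × ℝ => Circle.exp q.2 • q.1)
      (Continuous.measurable (by fun_prop))).aemeasurable

end CircleRMS

section Deviation

/-- The modulus `|p(z)| e^{-|z|²}` of a polynomial in the Gaussian weight. -/
noncomputable def weightedModulus (p : ℂ[X]) (z : ℂ) : ℝ :=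
  ‖p.eval z‖ * Real.exp (-‖z‖ ^ 2)

/-- The deviation `|p| e^{-|z|²} - 1_{D(0,R)}`, whose square is the discrepancy of `p`. -/
noncomputable def deviation (p : ℂ[X]) (R : ℝ) (z : ℂ) : ℝ :=
  weightedModulus p z - (Metric.ball (0 : ℂ) R).indicator (fun _ => (1 : ℝ)) z

@[fun_prop]
lemma continuous_weightedModulus (p : ℂ[X]) : Continuous (weightedModulus p) := by
  unfold weightedModulus
  fun_prop

@[fun_prop]
lemma measurable_ball_indicator (R : ℝ) :
    Measurable ((Metric.ball (0 : ℂ) R).indicator (fun _ => (1 : ℝ))) :=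
  measurable_const.indicator measurableSet_ball

@[fun_prop]
lemma measurable_deviation (p : ℂ[X]) (R : ℝ) : Measurable (deviation p R) :=
  (continuous_weightedModulus p).measurable.sub (measurable_ball_indicator R)

variable {μ : Measure ℂ} {R : ℝ}

lemma eLpNorm_two_ball_indicator :
    eLpNorm ((Metric.ball (0 : ℂ) R).indicator fun _ => (1 : ℝ)) 2 μ =
      μ (Metric.ball 0 R) ^ (1 / 2 : ℝ) := by
  rw [eLpNorm_indicator_const measurableSet_ball two_ne_zero ENNReal.ofNat_ne_top]
  simp

lemma eLpNorm_two_weightedModulus_le (p : ℂ[X]) :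
    eLpNorm (weightedModulus p) 2 μ ≤
      eLpNorm (deviation p R) 2 μ + μ (Metric.ball 0 R) ^ (1 / 2 : ℝ) := by
  have hp : weightedModulus p =
      deviation p R + (Metric.ball (0 : ℂ) R).indicator fun _ => (1 : ℝ) := by
    ext z
    simp [deviation]
  rw [hp, ← eLpNorm_two_ball_indicator]
  exact eLpNorm_add_le (by fun_prop) (by fun_prop) one_le_two

lemma eLpNorm_two_deviation_le (p : ℂ[X]) :
    eLpNorm (deviation p R) 2 μ ≤
      eLpNorm (weightedModulus p) 2 μ + μ (Metric.ball 0 R) ^ (1 / 2 : ℝ) := by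
  rw [← eLpNorm_two_ball_indicator]
  exact eLpNorm_sub_le (by fun_prop) (by fun_prop) one_le_two

lemma eLpNorm_two_deviation_le_add_sub (p g : ℂ[X]) :
    eLpNorm (deviation g R) 2 μ ≤
      eLpNorm (deviation p R) 2 μ + eLpNorm (weightedModulus (p - g)) 2 μ := by
  have hle (z : ℂ) :
      ‖(deviation g R - deviation p R) z‖ ≤ weightedModulus (p - g) z := by
    simp only [Pi.sub_apply, deviation, weightedModulus, sub_sub_sub_cancel_right, ← sub_mul,
      Polynomial.eval_sub, norm_mul, Real.norm_eq_abs, Real.abs_exp]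
    rw [norm_sub_rev]
    gcongr
    exact abs_norm_sub_norm_le _ _
  calc eLpNorm (deviation g R) 2 μ
      = eLpNorm (deviation p R + (deviation g R - deviation p R)) 2 μ := by
        rw [add_sub_cancel]
    _ ≤ eLpNorm (deviation p R) 2 μ + eLpNorm (deviation g R - deviation p R) 2 μ :=
        eLpNorm_add_le (by fun_prop) (by fun_prop) one_le_two
    _ ≤ _ := by
        gcongr
        exact eLpNorm_mono_real hle

section RotationInvariant

variable [SFinite μ] [SMulInvariantMeasure Circle ℂ μ]

lemma eLpNorm_two_weightedModulus_eq (p : ℂ[X]) :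
    eLpNorm (weightedModulus p) 2 μ =
      eLpNorm (fun z => circleRMS p ‖z‖ * Real.exp (-‖z‖ ^ 2)) 2 μ :=
  eLpNorm_two_eval_mul_radial (w := fun r => Real.exp (-r ^ 2)) p (by fun_prop)

lemma eLpNorm_two_weightedModulus_mono {p g : ℂ[X]} (h : ∀ k, ‖g.coeff k‖ ≤ ‖p.coeff k‖) :
    eLpNorm (weightedModulus g) 2 μ ≤ eLpNorm (weightedModulus p) 2 μ := by
  rw [eLpNorm_two_weightedModulus_eq, eLpNorm_two_weightedModulus_eq]
  refine eLpNorm_mono_real fun z => ?_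
  rw [Real.norm_of_nonneg (mul_nonneg (circleRMS_nonneg _ _) (Real.exp_nonneg _))]
  gcongr
  exact circleRMS_le_of_coeff_le h (norm_nonneg z)

lemma eLpNorm_two_deviation_le_of_coeff_le {p g : ℂ[X]} (h : ∀ k, ‖g.coeff k‖ ≤ ‖p.coeff k‖) :
    eLpNorm (deviation g R) 2 μ ≤
      eLpNorm (deviation p R) 2 μ + 2 * μ (Metric.ball 0 R) ^ (1 / 2 : ℝ) :=
  calc eLpNorm (deviation g R) 2 μ
      ≤ eLpNorm (weightedModulus g) 2 μ + μ (Metric.ball 0 R) ^ (1 / 2 : ℝ) :=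
        eLpNorm_two_deviation_le g
    _ ≤ eLpNorm (weightedModulus p) 2 μ + μ (Metric.ball 0 R) ^ (1 / 2 : ℝ) := by
        gcongr
        exact eLpNorm_two_weightedModulus_mono h
    _ ≤ eLpNorm (deviation p R) 2 μ + μ (Metric.ball 0 R) ^ (1 / 2 : ℝ) +
          μ (Metric.ball 0 R) ^ (1 / 2 : ℝ) := by
        gcongr
        exact eLpNorm_two_weightedModulus_le p
    _ = _ := by ring

end RotationInvariant

lemma preimage_circle_smul_ball (u : Circle) (r : ℝ) :
    (u • ·) ⁻¹' Metric.ball (0 : ℂ) r = Metric.ball 0 r := by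
  ext z
  simp

/-- The factor by which passing from `D(0,R)` to `D(0,cR)` decreases, per degree, the weighted
`L²` norm of a polynomial with no terms of degree below `2R²`. -/
noncomputable def contractionFactor (c : ℝ) : ℝ :=
  c * Real.exp ((1 - c ^ 2) / 2)

lemma contractionFactor_lt_one {c : ℝ} (hc : 0 < c) (hc1 : c < 1) : contractionFactor c < 1 := by
  have hlog : Real.log (c ^ 2) < c ^ 2 - 1 :=
    Real.log_lt_sub_one_of_pos (by positivity) (pow_lt_one₀ hc.le hc1 two_ne_zero).ne
  rw [Real.log_pow, Nat.cast_ofNat] at hlog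
  calc contractionFactor c = Real.exp (Real.log c + (1 - c ^ 2) / 2) := by
        rw [Real.exp_add, Real.exp_log hc, contractionFactor]
    _ < 1 := Real.exp_lt_one_iff.2 (by linarith)

lemma circleRMS_mul_exp_le {p : ℂ[X]} {n : ℕ} (hp : ∀ k < n, p.coeff k = 0) {c r : ℝ}
    (hc : 0 ≤ c) (hc1 : c ≤ 1) (hr : 0 ≤ r) (hn : 2 * r ^ 2 ≤ n) :
    circleRMS p (c * r) * Real.exp (-(c * r) ^ 2) ≤
      contractionFactor c ^ n * (circleRMS p r * Real.exp (-r ^ 2)) := by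
  have hexp : Real.exp (-(c * r) ^ 2) ≤ Real.exp ((1 - c ^ 2) / 2) ^ n * Real.exp (-r ^ 2) := by
    rw [← Real.exp_nat_mul, ← Real.exp_add, Real.exp_le_exp]
    nlinarith [pow_le_one₀ (n := 2) hc hc1]
  calc circleRMS p (c * r) * Real.exp (-(c * r) ^ 2)
      ≤ (c ^ n * circleRMS p r) * (Real.exp ((1 - c ^ 2) / 2) ^ n * Real.exp (-r ^ 2)) := by
        gcongr
        · exact mul_nonneg (pow_nonneg hc n) (circleRMS_nonneg p r)
        · exact circleRMS_mul_le hp hc hc1 hr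
    _ = contractionFactor c ^ n * (circleRMS p r * Real.exp (-r ^ 2)) := by
        rw [contractionFactor]
        ring

variable [μ.IsAddHaarMeasure] [SMulInvariantMeasure Circle ℂ μ]

lemma eLpNorm_two_weightedModulus_ball_mul_le {p : ℂ[X]} {n : ℕ} (hp : ∀ k < n, p.coeff k = 0)
    {c : ℝ} (hc : 0 < c) (hc1 : c ≤ 1) (hn : 2 * R ^ 2 ≤ n) :
    eLpNorm (weightedModulus p) 2 (μ.restrict (Metric.ball 0 (c * R))) ≤
      ENNReal.ofReal (contractionFactor c ^ n) *
        eLpNorm (weightedModulus p) 2 (μ.restrict (Metric.ball 0 R)) := by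
  have hinv (r : ℝ) : SMulInvariantMeasure Circle ℂ (μ.restrict (Metric.ball 0 r)) :=
    smulInvariantMeasure_restrict μ fun u => preimage_circle_smul_ball u r
  rw [eLpNorm_two_weightedModulus_eq, eLpNorm_two_weightedModulus_eq]
  refine (eLpNorm_restrict_ball_mul_le μ 2 (Continuous.stronglyMeasurable (by fun_prop))
    hc hc1 R).trans (eLpNorm_le_mul_eLpNorm_of_ae_le_mul ?_ 2)
  filter_upwards [ae_restrict_mem measurableSet_ball] with z hz
  have hzR : ‖z‖ ≤ R := (mem_ball_zero_iff.1 hz).le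
  have hnonneg (r : ℝ) : 0 ≤ circleRMS p r * Real.exp (-r ^ 2) :=
    mul_nonneg (circleRMS_nonneg p r) (Real.exp_nonneg _)
  rw [Real.norm_of_nonneg (hnonneg _), Real.norm_of_nonneg (hnonneg _), norm_smul,
    Real.norm_of_nonneg hc.le]
  exact circleRMS_mul_exp_le hp hc.le hc1 (norm_nonneg z) (hn.trans' (by gcongr))

lemma eLpNorm_two_deviation_trunc_le {E : Set ℂ} (hE : ∀ u : Circle, (u • ·) ⁻¹' E = E)
    (hRE : Metric.ball 0 R ⊆ E) {c : ℝ} (hc : 0 < c) (hc1 : c ≤ 1) (hR : 0 ≤ R) {n : ℕ}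
    (hn : 2 * R ^ 2 ≤ n) (p : ℂ[X]) :
    eLpNorm (deviation (PowerSeries.trunc n (p : PowerSeries ℂ)) R) 2 (μ.restrict E) ≤
      eLpNorm (deviation p R) 2 (μ.restrict E) +
        (ENNReal.ofReal (contractionFactor c ^ n) *
            (eLpNorm (deviation p R) 2 (μ.restrict E) + μ (Metric.ball 0 R) ^ (1 / 2 : ℝ)) +
          2 * μ (Metric.ball 0 R \ Metric.ball 0 (c * R)) ^ (1 / 2 : ℝ)) := by
  set g := PowerSeries.trunc n (p : PowerSeries ℂ)
  set D := Metric.ball (0 : ℂ) R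
  set B := Metric.ball (0 : ℂ) (c * R)
  have hBE : B ⊆ E := (Metric.ball_subset_ball (mul_le_of_le_one_left hR hc1)).trans hRE
  have hBinv (u : Circle) : (u • ·) ⁻¹' B = B := preimage_circle_smul_ball u _
  have hDinv : SMulInvariantMeasure Circle ℂ (μ.restrict D) :=
    smulInvariantMeasure_restrict μ fun u => preimage_circle_smul_ball u R
  have hEBinv : SMulInvariantMeasure Circle ℂ (μ.restrict (E \ B)) :=
    smulInvariantMeasure_restrict μ fun u => by rw [Set.preimage_sdiff, hE, hBinv]
  have hhigh : eLpNorm (weightedModulus (p - g)) 2 (μ.restrict D) ≤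
      eLpNorm (deviation p R) 2 (μ.restrict E) + μ D ^ (1 / 2 : ℝ) :=
    calc eLpNorm (weightedModulus (p - g)) 2 (μ.restrict D)
        ≤ eLpNorm (weightedModulus p) 2 (μ.restrict D) := 
          eLpNorm_two_weightedModulus_mono (norm_coeff_sub_trunc_le p n)
      _ ≤ eLpNorm (deviation p R) 2 (μ.restrict D) + μ.restrict D D ^ (1 / 2 : ℝ) :=
          eLpNorm_two_weightedModulus_le p
      _ ≤ eLpNorm (deviation p R) 2 (μ.restrict E) + μ D ^ (1 / 2 : ℝ) := by
          rw [Measure.restrict_apply_self]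
          gcongr
  refine eLpNorm_two_le_add_of_restrict_le (S := B) measurableSet_ball ?_ ?_
  · rw [Measure.restrict_restrict measurableSet_ball, Set.inter_eq_left.2 hBE]
    refine (eLpNorm_two_deviation_le_add_sub p g).trans ?_
    gcongr
    refine (eLpNorm_two_weightedModulus_ball_mul_le
      (fun k => coeff_sub_trunc_of_lt p) hc hc1 hn).trans ?_
    gcongr
  · rw [Measure.restrict_restrict measurableSet_ball.compl, Set.inter_comm, ← Set.sdiff_eq]
    refine (eLpNorm_two_deviation_le_of_coeff_le (norm_coeff_trunc_le p n)).trans ?_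
    rw [Measure.restrict_apply measurableSet_ball]
    gcongr
    exact fun z hz => ⟨hz.1, hz.2.2⟩

end Deviation

section Density

instance : SMulInvariantMeasure Circle ℂ (volume : Measure ℂ) where
  measure_preimage_smul u _ hs :=
    (rotation u).measurePreserving.measure_preimage hs.nullMeasurableSet

instance : SMulInvariantMeasure Circle ℂ areaMeasure := by
  unfold areaMeasure
  infer_instance

instance : areaMeasure.IsAddHaarMeasure :=
  Measure.IsAddHaarMeasure.smul _ (by simp [Real.pi_pos]) ENNReal.ofReal_ne_top

/-- The area measure normalized so that the disk `D(0,R)` has mass one. -/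
noncomputable def diskNormalizedArea (R : ℝ) : Measure ℂ :=
  (areaMeasure (Metric.ball 0 R))⁻¹ • areaMeasure

instance (R : ℝ) : SMulInvariantMeasure Circle ℂ (diskNormalizedArea R) := by
  unfold diskNormalizedArea
  infer_instance

variable {R : ℝ} {E : Set ℂ}

lemma isAddHaarMeasure_diskNormalizedArea (hR : 0 < R) :
    (diskNormalizedArea R).IsAddHaarMeasure :=
  Measure.IsAddHaarMeasure.smul _ (ENNReal.inv_ne_zero.2 measure_ball_lt_top.ne)
    (ENNReal.inv_ne_top.2 (Metric.measure_ball_pos _ _ hR).ne')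

lemma diskNormalizedArea_ball (hR : 0 < R) : diskNormalizedArea R (Metric.ball 0 R) = 1 :=
  ENNReal.inv_mul_cancel (Metric.measure_ball_pos _ _ hR).ne' measure_ball_lt_top.ne

lemma diskNormalizedArea_annulus {c : ℝ} (hc : 0 ≤ c) (hc1 : c ≤ 1) (hR : 0 < R) :
    diskNormalizedArea R (Metric.ball 0 R \ Metric.ball 0 (c * R)) =
      ENNReal.ofReal (1 - c ^ 2) := by
  have := isAddHaarMeasure_diskNormalizedArea hR
  rw [measure_sdiff (Metric.ball_subset_ball (mul_le_of_le_one_left hR.le hc1))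
      measurableSet_ball.nullMeasurableSet measure_ball_lt_top.ne,
    Measure.addHaar_ball_mul _ _ hc, diskNormalizedArea_ball hR, Complex.finrank_real_complex,
    mul_one, ENNReal.ofReal_sub _ (sq_nonneg c), ENNReal.ofReal_one]

/-- The root mean square over `E` of the deviation of `p`, normalized by the area of `D(0,R)`. -/
noncomputable def rmsDeviation (E : Set ℂ) (R : ℝ) (p : ℂ[X]) : ℝ≥0∞ :=
  eLpNorm (deviation p R) 2 ((diskNormalizedArea R).restrict E)

lemma rmsDeviation_sq (E : Set ℂ) (R : ℝ) (p : ℂ[X]) :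
    rmsDeviation E R p ^ 2 =
      (∫⁻ z in E, ENNReal.ofReal (discrepancy (fun z => p.eval z) R z) ∂areaMeasure) /
        areaMeasure (Metric.ball 0 R) := by
  rw [rmsDeviation, eLpNorm_two_sq, diskNormalizedArea, setLIntegral_smul_measure, smul_eq_mul,
    mul_comm, ← div_eq_mul_inv]
  rfl

lemma meanDiscrepancy_eval (p : ℂ[X]) (R : ℝ) :
    meanDiscrepancy (fun z => p.eval z) R = rmsDeviation (Metric.ball 0 R) R p ^ 2 := by
  rw [rmsDeviation_sq, meanDiscrepancy, setLIntegral_one]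

lemma tightMeanDiscrepancy_eval (p : ℂ[X]) (R : ℝ) :
    tightMeanDiscrepancy (fun z => p.eval z) R = rmsDeviation Set.univ R p ^ 2 := by
  rw [rmsDeviation_sq, tightMeanDiscrepancy, setLIntegral_one, setLIntegral_univ]

lemma rmsDeviation_zero_le (E : Set ℂ) (hR : 0 < R) : rmsDeviation E R 0 ≤ 1 := by
  calc rmsDeviation E R 0 ≤ eLpNorm (deviation 0 R) 2 (diskNormalizedArea R) :=
        eLpNorm_mono_measure _ Measure.restrict_le_self
    _ ≤ eLpNorm (weightedModulus 0) 2 (diskNormalizedArea R) +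
          diskNormalizedArea R (Metric.ball 0 R) ^ (1 / 2 : ℝ) := eLpNorm_two_deviation_le 0
    _ = 1 := by
        have h0 : weightedModulus 0 = 0 := by
          ext z
          simp [weightedModulus]
        rw [h0, eLpNorm_zero, diskNormalizedArea_ball hR, ENNReal.one_rpow, zero_add]

/-- The error committed by truncating below degree `n`, when the plane is split along `|z| = cR`. -/
noncomputable def truncationError (c : ℝ) (n : ℕ) : ℝ≥0∞ :=
  2 * ENNReal.ofReal (contractionFactor c ^ n) + 2 * ENNReal.ofReal (1 - c ^ 2) ^ (1 / 2 : ℝ)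

lemma iInf_polLT_rmsDeviation_le (hE : ∀ u : Circle, (u • ·) ⁻¹' E = E)
    (hRE : Metric.ball 0 R ⊆ E) (hR : 0 < R) {n : ℕ} (hn : 2 * R ^ 2 ≤ n) {c : ℝ} (hc : 0 < c)
    (hc1 : c ≤ 1) :
    ⨅ p ∈ polLT n, rmsDeviation E R p ≤ (⨅ p, rmsDeviation E R p) + truncationError c n := by
  have := isAddHaarMeasure_diskNormalizedArea hR
  rw [ENNReal.iInf_add]
  refine le_iInf fun p => ?_
  rcases le_total (rmsDeviation E R p) 1 with hp | hp
  · refine (iInf₂_le (PowerSeries.trunc n (p : PowerSeries ℂ))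
      (PowerSeries.degree_trunc_lt _ n)).trans ?_
    refine (eLpNorm_two_deviation_trunc_le hE hRE hc hc1 hR.le hn p).trans ?_
    rw [diskNormalizedArea_ball hR, diskNormalizedArea_annulus hc.le hc1 hR, ENNReal.one_rpow,
      truncationError, mul_comm (2 : ℝ≥0∞) (ENNReal.ofReal (_ ^ n))]
    have hp2 : rmsDeviation E R p + 1 ≤ 2 := by
      rw [← one_add_one_eq_two]
      gcongr
    unfold rmsDeviation at hp2 ⊢
    gcongr
  · have hzero : (0 : ℂ[X]) ∈ polLT n := by simp [polLT]
    calc ⨅ p ∈ polLT n, rmsDeviation E R p ≤ rmsDeviation E R 0 := iInf₂_le 0 hzero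
      _ ≤ rmsDeviation E R p := (rmsDeviation_zero_le E hR).trans hp
      _ ≤ rmsDeviation E R p + truncationError c n := le_self_add

lemma exists_eventually_truncationError_lt {ε : ℝ≥0∞} (hε : 0 < ε) :
    ∃ c : ℝ, 0 < c ∧ c ≤ 1 ∧ ∀ᶠ n in atTop, truncationError c n < ε := by
  obtain ⟨c, hcε, hc, hc1⟩ : ∃ c : ℝ,
      2 * ENNReal.ofReal (1 - c ^ 2) ^ (1 / 2 : ℝ) < ε ∧ 0 < c ∧ c < 1 := by
    have hlim : Tendsto (fun c : ℝ => 2 * ENNReal.ofReal (1 - c ^ 2) ^ (1 / 2 : ℝ))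
        (nhdsWithin 1 (Set.Iio 1)) (nhds 0) := by
      have hcont : Continuous fun c : ℝ => 2 * ENNReal.ofReal (1 - c ^ 2) ^ (1 / 2 : ℝ) :=
        (ENNReal.continuous_const_mul (a := 2) ENNReal.ofNat_ne_top).comp <|
          ENNReal.continuous_rpow_const.comp <| ENNReal.continuous_ofReal.comp (by fun_prop)
      exact (hcont.tendsto' 1 0 (by simp)).mono_left nhdsWithin_le_nhds
    exact ((hlim.eventually_lt_const hε).and (Ioo_mem_nhdsLT zero_lt_one)).exists
  refine ⟨c, hc, hc1.le, ?_⟩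
  have hpow : Tendsto (truncationError c) atTop
      (nhds (2 * ENNReal.ofReal (1 - c ^ 2) ^ (1 / 2 : ℝ))) := by
    have hfactor : Tendsto (fun n : ℕ => contractionFactor c ^ n) atTop (nhds 0) :=
      tendsto_pow_atTop_nhds_zero_of_lt_one (mul_nonneg hc.le (Real.exp_nonneg _))
        (contractionFactor_lt_one hc hc1)
    have hsum := (ENNReal.Tendsto.const_mul (a := 2) (ENNReal.tendsto_ofReal hfactor)
      (.inr ENNReal.ofNat_ne_top)).add_const (2 * ENNReal.ofReal (1 - c ^ 2) ^ (1 / 2 : ℝ))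
    rwa [ENNReal.ofReal_zero, mul_zero, zero_add] at hsum
  exact hpow.eventually_lt_const hcε

lemma tendsto_degreeBound : Tendsto degreeBound atTop atTop :=
  tendsto_nat_ceil_atTop.comp ((tendsto_pow_atTop two_ne_zero).const_mul_atTop two_pos)

lemma liminf_iInf_polLT_rmsDeviation {E : ℝ → Set ℂ}
    (hE : ∀ R, ∀ u : Circle, (u • ·) ⁻¹' E R = E R) (hRE : ∀ R, Metric.ball 0 R ⊆ E R) :
    liminf (fun R => ⨅ p ∈ polLT (degreeBound R), rmsDeviation (E R) R p) atTop =
      liminf (fun R => ⨅ p, rmsDeviation (E R) R p) atTop := by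
  refine le_antisymm (ENNReal.le_of_forall_pos_le_add fun ε hε _ => ?_)
    (liminf_le_liminf (.of_forall fun R => le_iInf₂ fun p _ => iInf_le _ p))
  obtain ⟨c, hc, hc1, herr⟩ := exists_eventually_truncationError_lt (ENNReal.coe_pos.2 hε)
  rw [← liminf_add_const atTop _ _ (by isBoundedDefault) (by isBoundedDefault)]
  refine liminf_le_liminf ?_
  filter_upwards [tendsto_degreeBound.eventually herr, eventually_gt_atTop 0] with R hRε hR
  refine (iInf_polLT_rmsDeviation_le (hE R) (hRE R) hR (Nat.le_ceil _) hc hc1).trans ?_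
  gcongr
  exact hRε.le

lemma liminf_iInf_polLT_rmsDeviation_sq {E : ℝ → Set ℂ}
    (hE : ∀ R, ∀ u : Circle, (u • ·) ⁻¹' E R = E R) (hRE : ∀ R, Metric.ball 0 R ⊆ E R) :
    liminf (fun R => ⨅ p ∈ polLT (degreeBound R), rmsDeviation (E R) R p ^ 2) atTop =
      liminf (fun R => ⨅ p, rmsDeviation (E R) R p ^ 2) atTop := by
  have hsq (x : ℝ≥0∞) : x ^ 2 = ENNReal.orderIsoRpow 2 two_pos x := (ENNReal.rpow_two x).symm
  simp_rw [hsq, ← OrderIso.map_iInf]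
  rw [← OrderIso.liminf_apply, ← OrderIso.liminf_apply, liminf_iInf_polLT_rmsDeviation hE hRE]

end Density

end PlanarDiscrepancy

theorem corollary1p5 :
    liminf (fun R : ℝ =>
        ⨅ p ∈ PlanarDiscrepancy.polLT (PlanarDiscrepancy.degreeBound R),
          PlanarDiscrepancy.meanDiscrepancy (fun z => Polynomial.eval z p) R) atTop
      = PlanarDiscrepancy.planarDensity ∧
    liminf (fun R : ℝ =>
        ⨅ p ∈ PlanarDiscrepancy.polLT (PlanarDiscrepancy.degreeBound R),
          PlanarDiscrepancy.tightMeanDiscrepancy (fun z => Polynomial.eval z p) R) atTop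
      = PlanarDiscrepancy.tightPlanarDensity := by
  unfold PlanarDiscrepancy.planarDensity PlanarDiscrepancy.tightPlanarDensity
  simp_rw [PlanarDiscrepancy.meanDiscrepancy_eval, PlanarDiscrepancy.tightMeanDiscrepancy_eval]
  exact ⟨PlanarDiscrepancy.liminf_iInf_polLT_rmsDeviation_sq
      (fun R u => PlanarDiscrepancy.preimage_circle_smul_ball u R) fun _ => subset_rfl,
    PlanarDiscrepancy.liminf_iInf_polLT_rmsDeviation_sq
      (fun _ _ => Set.preimage_univ) fun _ => Set.subset_univ _⟩
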